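/- For $\theta=(\alpha,\beta)\in(0,\infty)^2$ let $$p_{\alpha,\beta}(x)=\frac{\Gamma(\alpha+\beta)}{\Gamma(\alpha)\Gamma(\beta)}\,x^{\alpha-1}(1-x)^{\beta-1},\qquad 0<x<1,$$ be the density of the beta distribution $B(\alpha,\beta)$, and let $$g_{ij}(\theta)=-E_\theta\!\left[\frac{\partial^2}{\partial\theta_i\,\partial\theta_j}\ln p_\theta(X)\right],\qquad i,j\in\{1,2\},\quad X\sim B(\alpha,\beta),$$ be the Fisher information matrix. Then these expectations exist and $g$ is a smooth Riemannian metric on $(0,\infty)^2$ (the Fisher–Rao metric), and its sectional curvature $K(\alpha,\beta)$ is negative at every point and bounded from below: $K(\alpha,\beta)<0$ for all $\alpha,\beta>0$, and $$\inf_{\alpha,\beta>0}K(\alpha,\beta)>-\infty .$$ -/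

import Mathlib

open MeasureTheory ProbabilityTheory
open scoped ContDiff

noncomputable section

namespace BetaGeometry

/-! ### Riemannian geometry in the standard coordinates of an open subset of `ℝᵈ` -/

/-- The partial derivative `∂f/∂θ_i` at `θ`. -/
def partialDeriv {d : ℕ} (i : Fin d) (f : (Fin d → ℝ) → ℝ) (θ : Fin d → ℝ) : ℝ :=
  lineDeriv ℝ f θ (Pi.single i 1)

/-- A Riemannian metric on `Θ`, given by its matrix in coordinates: the matrix is symmetric
positive definite at each point and its entries are smooth functions. -/
structure IsRiemannianMetricOn {d : ℕ} (g : (Fin d → ℝ) → Matrix (Fin d) (Fin d) ℝ)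
    (Θ : Set (Fin d → ℝ)) : Prop where
  posDef : ∀ θ ∈ Θ, (g θ).PosDef
  smooth : ∀ i j, ContDiffOn ℝ ∞ (fun θ => g θ i j) Θ

/-- The scalar product `g_θ(u, v) = uᵗ g(θ) v`. -/
def metricInner {d : ℕ} (g : (Fin d → ℝ) → Matrix (Fin d) (Fin d) ℝ) (θ u v : Fin d → ℝ) : ℝ :=
  ∑ i, ∑ j, u i * g θ i j * v j

/-- The Christoffel symbols of the second kind (of the Levi-Civita connection),
`Γ^k_{ij} = ½ ∑_l g^{kl} (∂_i g_{jl} + ∂_j g_{il} - ∂_l g_{ij})`. -/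
def christoffel {d : ℕ} (g : (Fin d → ℝ) → Matrix (Fin d) (Fin d) ℝ) (k i j : Fin d)
    (θ : Fin d → ℝ) : ℝ :=
  (1 / 2 : ℝ) * ∑ l, (g θ)⁻¹ k l *
    (partialDeriv i (fun η => g η j l) θ + partialDeriv j (fun η => g η i l) θ
      - partialDeriv l (fun η => g η i j) θ)

/-- The components `R^l_{ijk}` of the Riemann curvature tensor
`R(X, Y)Z = ∇_X ∇_Y Z - ∇_Y ∇_X Z - ∇_{[X,Y]} Z`, that is `R(∂_i, ∂_j) ∂_k = ∑_l R^l_{ijk} ∂_l`. -/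
def riemannTensor {d : ℕ} (g : (Fin d → ℝ) → Matrix (Fin d) (Fin d) ℝ) (l i j k : Fin d)
    (θ : Fin d → ℝ) : ℝ :=
  partialDeriv i (christoffel g l j k) θ - partialDeriv j (christoffel g l i k) θ
    + ∑ m, (christoffel g l i m θ * christoffel g m j k θ
      - christoffel g l j m θ * christoffel g m i k θ)

/-- The vector `R(u, v) w` at `θ`. -/
def curvatureVector {d : ℕ} (g : (Fin d → ℝ) → Matrix (Fin d) (Fin d) ℝ)
    (θ u v w : Fin d → ℝ) : Fin d → ℝ :=
  fun l => ∑ i, ∑ j, ∑ k, riemannTensor g l i j k θ * u i * v j * w k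

/-- The sectional curvature at `θ` of the plane spanned by `u` and `v` (for linearly independent
`u`, `v`): `g(R(u, v) v, u) / (g(u, u) g(v, v) - g(u, v)²)`. -/
def sectionalCurvature {d : ℕ} (g : (Fin d → ℝ) → Matrix (Fin d) (Fin d) ℝ)
    (θ u v : Fin d → ℝ) : ℝ :=
  metricInner g θ (curvatureVector g θ u v v) u /
    (metricInner g θ u u * metricInner g θ v v - metricInner g θ u v ^ 2)

/-! ### The Fisher information metric of a parametric family of densities -/

/-- The second logarithmic derivative `∂²/∂θ_i∂θ_j ln p(x; θ)`. -/
def logDensityHessian {d : ℕ} {X : Type*} (p : (Fin d → ℝ) → X → ℝ) (i j : Fin d)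
    (θ : Fin d → ℝ) (x : X) : ℝ :=
  partialDeriv i (partialDeriv j fun η => Real.log (p η x)) θ

/-- The distribution with density `p(·; θ)` with respect to the dominating measure `μ`. -/
def densityMeasure {d : ℕ} {X : Type*} [MeasurableSpace X] (μ : Measure X)
    (p : (Fin d → ℝ) → X → ℝ) (θ : Fin d → ℝ) : Measure X :=
  μ.withDensity fun x => ENNReal.ofReal (p θ x)

/-- The Fisher information matrix `I(θ)_{ij} = -E_θ[∂²/∂θ_i∂θ_j ln p(X; θ)]`, which is the matrix
of the Fisher information metric at `θ`. -/
def fisherInformation {d : ℕ} {X : Type*} [MeasurableSpace X] (μ : Measure X)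
    (p : (Fin d → ℝ) → X → ℝ) (θ : Fin d → ℝ) : Matrix (Fin d) (Fin d) ℝ :=
  Matrix.of fun i j => -∫ x, logDensityHessian p i j θ x ∂(densityMeasure μ p θ)

/-! ### The beta manifold -/

/-- The parameter space `(0, ∞)²`; the parameter is `(α, β) = (θ 0, θ 1)`. -/
def betaParameters : Set (Fin 2 → ℝ) := {θ | 0 < θ 0 ∧ 0 < θ 1}

/-- The beta density `Γ(α+β)/(Γ(α)Γ(β)) x^(α-1) (1-x)^(β-1)` for `0 < x < 1`, and `0` elsewhere. -/
def betaDensity (θ : Fin 2 → ℝ) (x : ℝ) : ℝ := betaPDFReal (θ 0) (θ 1) x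

/-- The matrix of the Fisher–Rao metric of the family of beta distributions. -/
def betaFisherMetric : (Fin 2 → ℝ) → Matrix (Fin 2) (Fin 2) ℝ :=
  fisherInformation (volume : Measure ℝ) betaDensity

end BetaGeometry

end

open BetaGeometry

open BetaGeometry
open Filter Topology Set MeasureTheory ProbabilityTheory
open scoped ContDiff

/-! Write ζₖ(t) = ∑ₙ (t + n)⁻ᵏ, so that ψ' = ζ₂ and ψ'' = -2ζ₃ for the digamma function ψ. For 0 < x
< 1 the Hessian of ln p does not depend on x, so the metric is diag(ζ₂(α), ζ₂(β)) minus ζ₂(α + β)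
times the all-ones matrix. Put S = 1/ζ₂(α+β) - 1/ζ₂(α) - 1/ζ₂(β), let R = ζ₂/ζ₃, and let D = R(α+β)
- R(α) - R(β). The determinant is ζ₂(α) ζ₂(β) ζ₂(α+β) S, and the curvature is K = -P(α) P(β) P(α+β)
D / S², where P = ζ₃/ζ₂² (`betaCurvature_eq`).

Positivity of the metric is superadditivity of 1/ζ₂, and negativity of K is superadditivity of R.
Both come from monotonicity of f(t)/t. For R this reduces to the delicate inequality
`hurwitzSum_two_mul_three_lt`, for 1/ζ₂ to `le_two_mul_hurwitzSum_three_sub`.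

For the lower bound everything is compared with m(t) = t/(t + 1). There are estimates P ≤ 4m, S ≥
m(α)m(β)/4 and D ≤ 20 min(m(α), m(β)), and m(α+β) ≤ 2 max(m(α), m(β)). Numerator and denominator are
then both controlled by m(α)²m(β)², which cancels.

All estimates on ζₖ come from telescoping against explicit rational functions. -/

/-! ### The series `∑ₙ (x + n)⁻ᵏ` -/

/-- The sum of a series dominated by the differences of a nonnegative sequence. -/
lemma tsum_le_of_le_sub_succ {f u : ℕ → ℝ} (hf : ∀ n, 0 ≤ f n) (hu : ∀ n, 0 ≤ u n)
    (h : ∀ n, f n ≤ u n - u (n + 1)) : ∑' n, f n ≤ u 0 := by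
  refine Real.tsum_le_of_sum_range_le hf fun N => ?_
  calc ∑ n ∈ Finset.range N, f n ≤ ∑ n ∈ Finset.range N, (u n - u (n + 1)) :=
        Finset.sum_le_sum fun n _ => h n
    _ = u 0 - u N := Finset.sum_range_sub' u N
    _ ≤ u 0 := by linarith [hu N]

/-- The sum of a series dominating the differences of a null sequence. -/
lemma le_tsum_of_sub_succ_le {f u : ℕ → ℝ} (hf : Summable f) (hu : Tendsto u atTop (𝓝 0))
    (h : ∀ n, u n - u (n + 1) ≤ f n) : u 0 ≤ ∑' n, f n := by
  have h1 : Tendsto (fun N => u 0 - u N) atTop (𝓝 (u 0 - 0)) := tendsto_const_nhds.sub hu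
  rw [sub_zero] at h1
  refine le_of_tendsto_of_tendsto' h1 hf.hasSum.tendsto_sum_nat fun N => ?_
  rw [← Finset.sum_range_sub' u N]
  exact Finset.sum_le_sum fun n _ => h n

/-- The Hurwitz zeta value `ζ(k, x) = ∑ₙ (x + n)⁻ᵏ` at a natural number `k`. -/
noncomputable def hurwitzSum (k : ℕ) (x : ℝ) : ℝ := ∑' n : ℕ, ((x + n) ^ k)⁻¹

lemma summable_hurwitzSum {k : ℕ} (hk : 2 ≤ k) {x : ℝ} (hx : 0 < x) :
    Summable fun n : ℕ => ((x + n) ^ k)⁻¹ := by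
  have h := (Real.summable_one_div_nat_add_rpow x k).2 (by exact_mod_cast hk)
  refine h.congr fun n => ?_
  have : 0 < (n : ℝ) + x := by positivity
  rw [abs_of_pos this, Real.rpow_natCast, one_div, add_comm]

lemma hurwitzSum_eq_add {k : ℕ} (hk : 2 ≤ k) {x : ℝ} (hx : 0 < x) :
    hurwitzSum k x = (x ^ k)⁻¹ + hurwitzSum k (x + 1) := by
  rw [hurwitzSum, (summable_hurwitzSum hk hx).tsum_eq_zero_add, hurwitzSum]
  simp only [Nat.cast_zero, add_zero, Nat.cast_add, Nat.cast_one]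
  congr 2
  ext n
  ring_nf

lemma hurwitzSum_pos {k : ℕ} (hk : 2 ≤ k) {x : ℝ} (hx : 0 < x) : 0 < hurwitzSum k x :=
  (summable_hurwitzSum hk hx).tsum_pos (fun n => by positivity) 0 (by positivity)

/-- The sum itself solves u(x) - u(x + 1) = x⁻ᵏ, so a nonnegative supersolution of this difference
equation lies above it. In the companion `le_hurwitzSum_of_sub_le` a subsolution has to vanish at
infinity. -/
lemma hurwitzSum_le_of_le_sub {k : ℕ} {u : ℝ → ℝ} (hu : ∀ x, 0 < x → 0 ≤ u x)
    (h : ∀ x, 0 < x → (x ^ k)⁻¹ ≤ u x - u (x + 1)) {x : ℝ} (hx : 0 < x) :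
    hurwitzSum k x ≤ u x := by
  have := tsum_le_of_le_sub_succ (f := fun n : ℕ => ((x + n) ^ k)⁻¹) (u := fun n : ℕ => u (x + n))
    (fun n => by positivity) (fun n => hu _ (by positivity))
    (fun n => by
      have := h (x + n) (by positivity)
      push_cast
      rwa [← add_assoc])
  simpa [hurwitzSum] using this

lemma le_hurwitzSum_of_sub_le {k : ℕ} (hk : 2 ≤ k) {u : ℝ → ℝ} (hu : Tendsto u atTop (𝓝 0))
    (h : ∀ x, 0 < x → u x - u (x + 1) ≤ (x ^ k)⁻¹) {x : ℝ} (hx : 0 < x) :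
    u x ≤ hurwitzSum k x := by
  have := le_tsum_of_sub_succ_le (f := fun n : ℕ => ((x + n) ^ k)⁻¹) (u := fun n : ℕ => u (x + n))
    (summable_hurwitzSum hk hx)
    (hu.comp (tendsto_atTop_add_const_left _ x tendsto_natCast_atTop_atTop))
    (fun n => by
      have := h (x + n) (by positivity)
      push_cast
      rwa [← add_assoc])
  simpa [hurwitzSum] using this

lemma tendsto_const_mul_inv_pow_zero (c : ℝ) {k : ℕ} (hk : k ≠ 0) :
    Tendsto (fun x : ℝ => c * (x ^ k)⁻¹) atTop (𝓝 0) := by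
  simpa using ((tendsto_pow_atTop hk).inv_tendsto_atTop).const_mul c

/-! ### Rational bounds for the sums, mostly truncated Euler–Maclaurin expansions -/

lemma hurwitzSum_two_le {x : ℝ} (hx : 0 < x) :
    hurwitzSum 2 x ≤ 1 / x + 1 / (2 * x ^ 2) + 1 / (6 * x ^ 3) := by
  refine hurwitzSum_le_of_le_sub (u := fun x => 1 / x + 1 / (2 * x ^ 2) + 1 / (6 * x ^ 3))
    (fun x hx => by positivity) (fun x hx => ?_) hx
  rw [← sub_nonneg]
  have : 1 / x + 1 / (2 * x ^ 2) + 1 / (6 * x ^ 3) - (1 / (x + 1) + 1 / (2 * (x + 1) ^ 2)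
      + 1 / (6 * (x + 1) ^ 3)) - (x ^ 2)⁻¹ = 1 / (6 * x ^ 3 * (x + 1) ^ 3) := by
    field_simp
    ring
  rw [this]
  positivity

lemma le_hurwitzSum_two {x : ℝ} (hx : 0 < x) : 1 / x + 1 / (2 * x ^ 2) ≤ hurwitzSum 2 x := by
  refine le_hurwitzSum_of_sub_le (u := fun x => 1 / x + 1 / (2 * x ^ 2)) le_rfl ?_
    (fun x hx => ?_) hx
  · convert! (tendsto_const_mul_inv_pow_zero 1 one_ne_zero).add
      (tendsto_const_mul_inv_pow_zero (1 / 2) two_ne_zero) using 2 <;> simp [field]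
  rw [← sub_nonneg]
  have : (x ^ 2)⁻¹ - (1 / x + 1 / (2 * x ^ 2) - (1 / (x + 1) + 1 / (2 * (x + 1) ^ 2)))
      = 1 / (2 * x ^ 2 * (x + 1) ^ 2) := by
    field_simp
    ring
  rw [this]
  positivity

lemma hurwitzSum_three_le {x : ℝ} (hx : 0 < x) :
    hurwitzSum 3 x ≤ 1 / (2 * x ^ 2) + 1 / (2 * x ^ 3) + 1 / (4 * x ^ 4) := by
  refine hurwitzSum_le_of_le_sub (u := fun x => 1 / (2 * x ^ 2) + 1 / (2 * x ^ 3) + 1 / (4 * x ^ 4))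
    (fun x hx => by positivity) (fun x hx => ?_) hx
  rw [← sub_nonneg]
  have : 1 / (2 * x ^ 2) + 1 / (2 * x ^ 3) + 1 / (4 * x ^ 4) - (1 / (2 * (x + 1) ^ 2)
      + 1 / (2 * (x + 1) ^ 3) + 1 / (4 * (x + 1) ^ 4)) - (x ^ 3)⁻¹
      = (2 * x + 1) / (4 * x ^ 4 * (x + 1) ^ 4) := by
    field_simp
    ring
  rw [this]
  positivity

lemma le_hurwitzSum_three {x : ℝ} (hx : 0 < x) :
    1 / (2 * x ^ 2) + 1 / (2 * x ^ 3) ≤ hurwitzSum 3 x := by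
  refine le_hurwitzSum_of_sub_le (u := fun x => 1 / (2 * x ^ 2) + 1 / (2 * x ^ 3)) (by simp) ?_
    (fun x hx => ?_) hx
  · convert! (tendsto_const_mul_inv_pow_zero (1 / 2) two_ne_zero).add
      (tendsto_const_mul_inv_pow_zero (1 / 2) three_ne_zero) using 2 <;> simp [field]
  rw [← sub_nonneg]
  have : (x ^ 3)⁻¹ - (1 / (2 * x ^ 2) + 1 / (2 * x ^ 3)
      - (1 / (2 * (x + 1) ^ 2) + 1 / (2 * (x + 1) ^ 3)))
      = (2 * x + 1) / (2 * x ^ 3 * (x + 1) ^ 3) := by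
    field_simp
    ring
  rw [this]
  positivity

/-- The coefficient of x⁻⁴ is 1 instead of the asymptotic 1/2, which absorbs the later terms and
keeps the correct order at the origin. -/
lemma hurwitzSum_four_le {x : ℝ} (hx : 0 < x) :
    hurwitzSum 4 x ≤ 1 / (3 * x ^ 3) + 1 / x ^ 4 := by
  refine hurwitzSum_le_of_le_sub (u := fun x => 1 / (3 * x ^ 3) + 1 / x ^ 4)
    (fun x hx => by positivity) (fun x hx => ?_) hx
  rw [← sub_nonneg]
  have : 1 / (3 * x ^ 3) + 1 / x ^ 4 - (1 / (3 * (x + 1) ^ 3) + 1 / (x + 1) ^ 4) - (x ^ 4)⁻¹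
      = (6 * x ^ 2 + 4 * x + 1) / (3 * x ^ 3 * (x + 1) ^ 4) := by
    field_simp
    ring
  rw [this]
  positivity

lemma le_hurwitzSum_four {x : ℝ} (hx : 0 < x) :
    1 / (3 * x ^ 3) + 1 / (2 * x ^ 4) ≤ hurwitzSum 4 x := by
  refine le_hurwitzSum_of_sub_le (u := fun x => 1 / (3 * x ^ 3) + 1 / (2 * x ^ 4)) (by simp) ?_
    (fun x hx => ?_) hx
  · convert! (tendsto_const_mul_inv_pow_zero (1 / 3) three_ne_zero).add
      (tendsto_const_mul_inv_pow_zero (1 / 2) four_ne_zero) using 2 <;> simp [field]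
  rw [← sub_nonneg]
  have : (x ^ 4)⁻¹ - (1 / (3 * x ^ 3) + 1 / (2 * x ^ 4)
      - (1 / (3 * (x + 1) ^ 3) + 1 / (2 * (x + 1) ^ 4)))
      = (10 * x ^ 2 + 10 * x + 3) / (6 * x ^ 4 * (x + 1) ^ 4) := by
    field_simp
    ring
  rw [this]
  positivity

/-! ### Termwise differentiation and smoothness of the sums -/

lemma hasDerivAt_inv_add_pow (k : ℕ) {c x : ℝ} (h : 0 < x + c) :
    HasDerivAt (fun y : ℝ => ((y + c) ^ k)⁻¹) (-k * ((x + c) ^ (k + 1))⁻¹) x := by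
  have h1 : HasDerivAt (fun y : ℝ => (y + c) ^ k) (k * (x + c) ^ (k - 1) * 1) x :=
    ((hasDerivAt_id x).add_const c).pow k
  refine (h1.inv (by positivity)).congr_deriv ?_
  rcases k with _ | k
  · simp
  · simp only [Nat.add_sub_cancel]
    field_simp
    ring

lemma hasDerivAt_hurwitzSum {k : ℕ} (hk : 2 ≤ k) {x : ℝ} (hx : 0 < x) :
    HasDerivAt (hurwitzSum k) (-k * hurwitzSum (k + 1) x) x := by
  -- On (x/2, ∞) the differentiated terms are dominated by their values at x/2.
  have hx2 : 0 < x / 2 := by positivity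
  have h := hasDerivAt_tsum_of_isPreconnected (𝕜 := ℝ) (t := Ioi (x / 2))
    (u := fun n : ℕ => k * ((x / 2 + n) ^ (k + 1))⁻¹)
    (g := fun (n : ℕ) y => ((y + n) ^ k)⁻¹)
    (g' := fun (n : ℕ) y => -k * ((y + n) ^ (k + 1))⁻¹) (y₀ := x) (y := x)
    ((summable_hurwitzSum (by omega) hx2).mul_left _) isOpen_Ioi isPreconnected_Ioi
    (fun n y hy => hasDerivAt_inv_add_pow k (by
      have : x / 2 < y := hy
      have := hx2.trans this
      positivity))
    (fun n y hy => by
      have hy : x / 2 < y := hy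
      have hy0 := hx2.trans hy
      rw [norm_mul, norm_neg, Real.norm_natCast, Real.norm_of_nonneg (by positivity)]
      gcongr)
    (by simp only [mem_Ioi]; linarith) (summable_hurwitzSum hk hx)
    (by simp only [mem_Ioi]; linarith)
  rw [tsum_mul_left] at h
  exact h

lemma contDiffOn_hurwitzSum {k : ℕ} (hk : 2 ≤ k) (n : ℕ) :
    ContDiffOn ℝ n (hurwitzSum k) (Ioi 0) := by
  -- Each derivative raises `k` by one, so all `k` are treated together.
  induction n generalizing k with
  | zero =>
    exact contDiffOn_zero.2 fun x hx =>
      (hasDerivAt_hurwitzSum hk hx).continuousAt.continuousWithinAt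
  | succ n ih =>
    push_cast
    refine (contDiffOn_succ_iff_deriv_of_isOpen isOpen_Ioi).2 ⟨fun x hx =>
      (hasDerivAt_hurwitzSum hk hx).differentiableAt.differentiableWithinAt, by simp, ?_⟩
    exact ((ih (k := k + 1) (by omega)).const_smul (-k : ℝ)).congr fun x hx =>
      (hasDerivAt_hurwitzSum hk hx).deriv

/-! ### The logarithmic derivative of the Gamma function -/

lemma Real.hasDerivAt_log_Gamma {x : ℝ} (hx : 0 < x) :
    HasDerivAt (fun y => Real.log (Real.Gamma y)) (logDeriv Real.Gamma x) x :=
  (Real.differentiableAt_Gamma fun m => by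
    have : (0 : ℝ) ≤ m := m.cast_nonneg
    linarith).hasDerivAt.log (Real.Gamma_pos_of_pos hx).ne'

lemma Real.log_Gamma_add_one {x : ℝ} (hx : 0 < x) :
    Real.log (Real.Gamma (x + 1)) = Real.log x + Real.log (Real.Gamma x) := by
  rw [Real.Gamma_add_one hx.ne', Real.log_mul hx.ne' (Real.Gamma_pos_of_pos hx).ne']

lemma Real.logDeriv_Gamma_add_one {x : ℝ} (hx : 0 < x) :
    logDeriv Real.Gamma (x + 1) = logDeriv Real.Gamma x + x⁻¹ := by
  have h1 : HasDerivAt (fun y => Real.log (Real.Gamma (y + 1)))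
      (logDeriv Real.Gamma (x + 1)) x :=
    (Real.hasDerivAt_log_Gamma (by positivity : 0 < x + 1)).comp_add_const x 1
  have h2 : HasDerivAt (fun y => Real.log (Real.Gamma (y + 1)))
      (x⁻¹ + logDeriv Real.Gamma x) x :=
    ((Real.hasDerivAt_log hx.ne').add (Real.hasDerivAt_log_Gamma hx)).congr_of_eventuallyEq
      ((lt_mem_nhds hx).mono fun y hy => Real.log_Gamma_add_one hy)
  rw [h1.unique h2, add_comm]

/-- The chord of log Γ over [x, x + 1] has slope log x, and log Γ is convex; the tangent at the
right endpoint gives the next bound. -/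
lemma Real.logDeriv_Gamma_le_log {x : ℝ} (hx : 0 < x) :
    logDeriv Real.Gamma x ≤ Real.log x := by
  have h := Real.convexOn_log_Gamma.le_slope_of_hasDerivAt (x := x) (y := x + 1) hx
    (by simp only [mem_Ioi]; positivity) (by linarith) (Real.hasDerivAt_log_Gamma hx)
  simpa [slope_def_field, Real.log_Gamma_add_one hx] using h

lemma Real.log_le_logDeriv_Gamma_add_one {x : ℝ} (hx : 0 < x) :
    Real.log x ≤ logDeriv Real.Gamma (x + 1) := by
  have h := Real.convexOn_log_Gamma.slope_le_of_hasDerivAt (x := x) (y := x + 1) hx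
    (by simp only [mem_Ioi]; positivity) (by linarith)
    (Real.hasDerivAt_log_Gamma (by positivity))
  simpa [slope_def_field, Real.log_Gamma_add_one hx] using h

lemma Real.logDeriv_Gamma_add_nat {x : ℝ} (hx : 0 < x) (N : ℕ) :
    logDeriv Real.Gamma (x + N) =
      logDeriv Real.Gamma x + ∑ n ∈ Finset.range N, (x + n)⁻¹ := by
  induction N with
  | zero => simp
  | succ N ih =>
    push_cast
    rw [← add_assoc, Real.logDeriv_Gamma_add_one (by positivity), ih, Finset.sum_range_succ,
      add_assoc]

lemma Real.tendsto_logDeriv_Gamma_sub_log {x : ℝ} (hx : 0 < x) :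
    Tendsto (fun N : ℕ => logDeriv Real.Gamma (x + N) - Real.log N) atTop (𝓝 0) := by
  have h (y : ℝ) : Tendsto (fun N : ℕ => Real.log (N + y) - Real.log N) atTop (𝓝 0) :=
    (Real.tendsto_log_comp_add_sub_log y).comp tendsto_natCast_atTop_atTop
  refine tendsto_of_tendsto_of_tendsto_of_le_of_le' (h (x - 1)) (h x) ?_ ?_
  · filter_upwards [eventually_ge_atTop 1] with N hN
    have hN : (1 : ℝ) ≤ N := by exact_mod_cast hN
    have := Real.log_le_logDeriv_Gamma_add_one (x := N + (x - 1)) (by linarith)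
    rw [show (N : ℝ) + (x - 1) + 1 = x + N by ring] at this
    linarith
  · filter_upwards with N
    have := Real.logDeriv_Gamma_le_log (x := x + N) (by positivity)
    rw [add_comm (N : ℝ) x]
    linarith

/-- Iterating the recurrence of ψ and using ψ(x + N) - log N → 0 gives ψ(y) = ψ(1) + ∑ₙ (1/(1 + n) -
1/(y + n)), which is differentiated termwise. -/
lemma Real.hasDerivAt_logDeriv_Gamma {x : ℝ} (hx : 0 < x) :
    HasDerivAt (logDeriv Real.Gamma) (hurwitzSum 2 x) x := by
  have key : ∀ y ∈ Ioi (0 : ℝ), (Summable fun n : ℕ => (1 + n : ℝ)⁻¹ - (y + n)⁻¹) ∧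
      HasDerivAt (fun z : ℝ => ∑' n : ℕ, ((1 + n : ℝ)⁻¹ - (z + n)⁻¹)) (hurwitzSum 2 y) y := by
    intro y (hy : 0 < y)
    -- The half-line from min(y, 1)/2 contains both y and 1. At 1 all terms vanish, which provides
    -- the required point of convergence.
    have hm : 0 < min y 1 / 2 := by positivity
    have hy1 : y ∈ Ioi (min y 1 / 2) := by
      have := min_le_left y 1
      simp only [mem_Ioi]
      linarith
    have h1 : (1 : ℝ) ∈ Ioi (min y 1 / 2) := by
      have := min_le_right y 1
      simp only [mem_Ioi]
      linarith
    have hg : ∀ (n : ℕ) (z : ℝ), z ∈ Ioi (min y 1 / 2) →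
        HasDerivAt (fun z : ℝ => (1 + n : ℝ)⁻¹ - (z + n)⁻¹) ((z + n) ^ 2)⁻¹ z := by
      intro n z hz
      have hz0 : 0 < z := hm.trans hz
      have := (hasDerivAt_inv_add_pow 1 (c := (n : ℝ)) (x := z) (by positivity)).const_sub
        ((1 + n : ℝ)⁻¹)
      simpa using this
    have hg' : ∀ (n : ℕ) (z : ℝ), z ∈ Ioi (min y 1 / 2) →
        ‖((z + n) ^ 2)⁻¹‖ ≤ ((min y 1 / 2 + n) ^ 2)⁻¹ := by
      intro n z (hz : _ < z)
      have hz0 : 0 < z := hm.trans hz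
      rw [Real.norm_of_nonneg (by positivity)]
      gcongr
    have hs := summable_hurwitzSum le_rfl hm
    exact ⟨summable_of_summable_hasDerivAt_of_isPreconnected hs isOpen_Ioi isPreconnected_Ioi hg
        hg' h1 (by simp) hy1,
      hasDerivAt_tsum_of_isPreconnected hs isOpen_Ioi isPreconnected_Ioi hg hg' h1 (by simp) hy1⟩
  have heq : ∀ y ∈ Ioi (0 : ℝ), logDeriv Real.Gamma y =
      logDeriv Real.Gamma 1 + ∑' n : ℕ, ((1 + n : ℝ)⁻¹ - (y + n)⁻¹) := by
    intro y (hy : 0 < y)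
    have h1 := (key y hy).1.hasSum.tendsto_sum_nat.const_add (logDeriv Real.Gamma 1)
    have h2 := ((Real.tendsto_logDeriv_Gamma_sub_log one_pos).sub
      (Real.tendsto_logDeriv_Gamma_sub_log hy)).const_add (logDeriv Real.Gamma y)
    rw [sub_zero, add_zero] at h2
    refine tendsto_nhds_unique h2 (h1.congr fun N => ?_)
    rw [Real.logDeriv_Gamma_add_nat one_pos, Real.logDeriv_Gamma_add_nat hy,
      Finset.sum_sub_distrib]
    ring
  exact (((key x hx).2).const_add _).congr_of_eventuallyEq
    ((lt_mem_nhds hx).mono fun y hy => heq y hy)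

/-! ### Inequalities between trigamma and its derivatives -/

/-- Cruder than `hurwitzSum_two_le` at infinity, but of the right order at the origin too; likewise
for the next bound. -/
lemma hurwitzSum_two_le_inv_add_inv_sq {x : ℝ} (hx : 0 < x) :
    hurwitzSum 2 x ≤ 1 / x + 1 / x ^ 2 := by
  refine hurwitzSum_le_of_le_sub (u := fun x => 1 / x + 1 / x ^ 2)
    (fun x hx => by positivity) (fun x hx => ?_) hx
  rw [← sub_nonneg]
  have : 1 / x + 1 / x ^ 2 - (1 / (x + 1) + 1 / (x + 1) ^ 2) - (x ^ 2)⁻¹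
      = 1 / (x * (x + 1) ^ 2) := by
    field_simp
    ring
  rw [this]
  positivity

lemma hurwitzSum_three_le_inv_sq_add_inv_cube {x : ℝ} (hx : 0 < x) :
    hurwitzSum 3 x ≤ 1 / (2 * x ^ 2) + 1 / x ^ 3 := by
  refine hurwitzSum_le_of_le_sub (u := fun x => 1 / (2 * x ^ 2) + 1 / x ^ 3)
    (fun x hx => by positivity) (fun x hx => ?_) hx
  rw [← sub_nonneg]
  have : 1 / (2 * x ^ 2) + 1 / x ^ 3 - (1 / (2 * (x + 1) ^ 2) + 1 / (x + 1) ^ 3) - (x ^ 3)⁻¹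
      = (3 * x + 1) / (2 * x ^ 2 * (x + 1) ^ 3) := by
    field_simp
    ring
  rw [this]
  positivity

/-- Says that R(x)/x has positive derivative. The leading terms of the two sides agree at both ends
(3/x⁵ at 0, 1/x³ at infinity). Hence the n = 0 term is kept exactly and the expansions are applied
only at x + 1. -/
lemma hurwitzSum_two_mul_three_lt {x : ℝ} (hx : 0 < x) :
    hurwitzSum 2 x * hurwitzSum 3 x + 2 * x * hurwitzSum 3 x ^ 2 <
      3 * x * (hurwitzSum 2 x * hurwitzSum 4 x) := by
  have hw : 0 < x + 1 := by positivity
  have h2 : 1 / x ^ 2 + (1 / (x + 1) + 1 / (2 * (x + 1) ^ 2)) ≤ hurwitzSum 2 x := by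
    rw [hurwitzSum_eq_add le_rfl hx, one_div (x ^ 2)]
    gcongr
    exact le_hurwitzSum_two hw
  have h3 : hurwitzSum 3 x ≤
      1 / x ^ 3 + (1 / (2 * (x + 1) ^ 2) + 1 / (2 * (x + 1) ^ 3) + 1 / (4 * (x + 1) ^ 4)) := by
    rw [hurwitzSum_eq_add (by norm_num) hx, one_div (x ^ 3)]
    gcongr
    exact hurwitzSum_three_le hw
  have h4 : 1 / x ^ 4 + (1 / (3 * (x + 1) ^ 3) + 1 / (2 * (x + 1) ^ 4)) ≤ hurwitzSum 4 x := by
    rw [hurwitzSum_eq_add (by norm_num) hx, one_div (x ^ 4)]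
    gcongr
    exact le_hurwitzSum_four hw
  have p2 := hurwitzSum_pos le_rfl hx
  have p3 := hurwitzSum_pos (k := 3) (by norm_num) hx
  generalize hurwitzSum 2 x = s2 at *
  generalize hurwitzSum 3 x = s3 at *
  generalize hurwitzSum 4 x = s4 at *
  set l2 := 1 / x ^ 2 + (1 / (x + 1) + 1 / (2 * (x + 1) ^ 2)) with hl2
  set u3 := 1 / x ^ 3 + (1 / (2 * (x + 1) ^ 2) + 1 / (2 * (x + 1) ^ 3) + 1 / (4 * (x + 1) ^ 4))
    with hu3
  set l4 := 1 / x ^ 4 + (1 / (3 * (x + 1) ^ 3) + 1 / (2 * (x + 1) ^ 4)) with hl4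
  -- Grouped as s2 (3x s4 - s3) > 2x s3², the inequality is monotone in each bound once this factor
  -- is nonnegative.
  have e1 : 0 ≤ 3 * x * l4 - u3 := by
    have : 3 * x * l4 - u3 =
        (8 + 32 * x + 48 * x ^ 2 + 27 * x ^ 3 + 12 * x ^ 4 + 2 * x ^ 5) / (4 * x ^ 3 * (x + 1) ^ 4) := by
      rw [hl4, hu3]
      field_simp
      ring
    rw [this]
    positivity
  have e2 : 0 < l2 * (3 * x * l4 - u3) - 2 * x * u3 ^ 2 := by
    have : l2 * (3 * x * l4 - u3) - 2 * x * u3 ^ 2 =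
        (24 + 110 * x + 216 * x ^ 2 + 233 * x ^ 3 + 139 * x ^ 4 +
          45 * x ^ 5 + 10 * x ^ 6 + 2 * x ^ 7) / (8 * x ^ 3 * (x + 1) ^ 8) := by
      rw [hl4, hu3, hl2]
      field_simp
      ring
    rw [this]
    positivity
  have e3 : l2 * (3 * x * l4 - u3) ≤ s2 * (3 * x * s4 - s3) := by gcongr
  have e4 : 2 * x * s3 ^ 2 ≤ 2 * x * u3 ^ 2 := by gcongr
  linarith

/-- The right side is minus the derivative of x ζ₂(x). It yields both R(x) ≤ 2x and the
superadditivity of 1/ζ₂. -/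
lemma le_two_mul_hurwitzSum_three_sub {x : ℝ} (hx : 0 < x) :
    1 / (4 * x ^ 2) ≤ 2 * x * hurwitzSum 3 x - hurwitzSum 2 x := by
  have hw : 0 < x + 1 := by positivity
  have h2 : hurwitzSum 2 x ≤
      1 / x ^ 2 + (1 / (x + 1) + 1 / (2 * (x + 1) ^ 2) + 1 / (6 * (x + 1) ^ 3)) := by
    rw [hurwitzSum_eq_add le_rfl hx, one_div (x ^ 2)]
    gcongr
    exact hurwitzSum_two_le hw
  have h3 : 1 / x ^ 3 + (1 / (2 * (x + 1) ^ 2) + 1 / (2 * (x + 1) ^ 3)) ≤ hurwitzSum 3 x := by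
    rw [hurwitzSum_eq_add (by norm_num) hx, one_div (x ^ 3)]
    gcongr
    exact le_hurwitzSum_three hw
  have e : 2 * x * (1 / x ^ 3 + (1 / (2 * (x + 1) ^ 2) + 1 / (2 * (x + 1) ^ 3))) -
      (1 / x ^ 2 + (1 / (x + 1) + 1 / (2 * (x + 1) ^ 2) + 1 / (6 * (x + 1) ^ 3))) -
      1 / (4 * x ^ 2) = (3 * x ^ 3 + 7 * x ^ 2 + 27 * x + 9) / (12 * x ^ 2 * (x + 1) ^ 3) := by
    field_simp
    ring
  have e' : 0 ≤ (3 * x ^ 3 + 7 * x ^ 2 + 27 * x + 9) / (12 * x ^ 2 * (x + 1) ^ 3) := by positivity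
  have := mul_le_mul_of_nonneg_left h3 (by positivity : 0 ≤ 2 * x)
  linarith

lemma hurwitzSum_two_mul_four_le {x : ℝ} (hx : 0 < x) :
    hurwitzSum 2 x * hurwitzSum 4 x ≤ 4 * hurwitzSum 3 x ^ 2 := by
  calc hurwitzSum 2 x * hurwitzSum 4 x
      ≤ (1 / x + 1 / x ^ 2) * (1 / (3 * x ^ 3) + 1 / x ^ 4) :=
        mul_le_mul (hurwitzSum_two_le_inv_add_inv_sq hx) (hurwitzSum_four_le hx)
          (hurwitzSum_pos (by norm_num) hx).le (by positivity)
    _ ≤ 4 * (1 / (2 * x ^ 2) + 1 / (2 * x ^ 3)) ^ 2 := by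
        rw [← sub_nonneg]
        have : 4 * (1 / (2 * x ^ 2) + 1 / (2 * x ^ 3)) ^ 2 -
            (1 / x + 1 / x ^ 2) * (1 / (3 * x ^ 3) + 1 / x ^ 4) =
            2 * (x + 1) / (3 * x ^ 5) := by
          field_simp
          ring
        rw [this]
        positivity
    _ ≤ 4 * hurwitzSum 3 x ^ 2 := by
        gcongr
        exact le_hurwitzSum_three hx

/-- The ratio `ζ(2, x) / ζ(3, x) = -2 ψ'(x) / ψ''(x)`. -/
noncomputable def hurwitzRatio (x : ℝ) : ℝ := hurwitzSum 2 x / hurwitzSum 3 x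

lemma hasDerivAt_hurwitzRatio {x : ℝ} (hx : 0 < x) :
    HasDerivAt hurwitzRatio
      ((-2 * hurwitzSum 3 x ^ 2 + 3 * (hurwitzSum 2 x * hurwitzSum 4 x)) / hurwitzSum 3 x ^ 2)
      x := by
  refine ((hasDerivAt_hurwitzSum le_rfl hx).div (hasDerivAt_hurwitzSum (by norm_num) hx)
    (hurwitzSum_pos (by norm_num) hx).ne').congr_deriv ?_
  push_cast
  ring

lemma hurwitzRatio_le {x : ℝ} (hx : 0 < x) : hurwitzRatio x ≤ 2 * x := by
  rw [hurwitzRatio, div_le_iff₀ (hurwitzSum_pos (by norm_num) hx)]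
  have := le_two_mul_hurwitzSum_three_sub hx
  have h : 0 ≤ 1 / (4 * x ^ 2) := by positivity
  linarith

/-- Together with `hurwitzRatio_le`, this bounds the superadditivity defect of R by 6. -/
lemma le_hurwitzRatio {x : ℝ} (hx : 0 < x) : 2 * x - 3 ≤ hurwitzRatio x := by
  have h3 := hurwitzSum_pos (k := 3) (by norm_num) hx
  have h2 := hurwitzSum_pos le_rfl hx
  rcases le_total (2 * x) 3 with h | h
  · exact (sub_nonpos.2 h).trans (div_pos h2 h3).le
  rw [hurwitzRatio, le_div_iff₀ h3]
  calc (2 * x - 3) * hurwitzSum 3 x ≤ (2 * x - 3) * (1 / (2 * x ^ 2) + 1 / x ^ 3) :=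
        mul_le_mul_of_nonneg_left (hurwitzSum_three_le_inv_sq_add_inv_cube hx) (by linarith)
    _ ≤ 1 / x + 1 / (2 * x ^ 2) := by
        rw [← sub_nonneg]
        have : 1 / x + 1 / (2 * x ^ 2) - (2 * x - 3) * (1 / (2 * x ^ 2) + 1 / x ^ 3) =
            3 / x ^ 3 := by
          field_simp
          ring
        rw [this]
        positivity
    _ ≤ _ := le_hurwitzSum_two hx

/-- Up to a positive factor the derivative is the difference of the two sides of
`hurwitzSum_two_mul_three_lt`. -/
lemma strictMonoOn_hurwitzRatio_div : StrictMonoOn (fun x => hurwitzRatio x / x) (Ioi 0) := by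
  have hd : ∀ x ∈ Ioi (0 : ℝ), HasDerivAt (fun x => hurwitzRatio x / x) _ x := fun x hx =>
    (hasDerivAt_hurwitzRatio hx).div (hasDerivAt_id x) (ne_of_gt hx)
  refine strictMonoOn_of_deriv_pos (convex_Ioi 0)
    (fun x hx => (hd x hx).continuousAt.continuousWithinAt) fun x hx => ?_
  rw [interior_Ioi] at hx
  have hx0 : 0 < x := hx
  rw [(hd x hx).deriv]
  have h3 := hurwitzSum_pos (k := 3) (by norm_num) hx0
  have := hurwitzSum_two_mul_three_lt hx0
  refine div_pos ?_ (by positivity)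
  have e : (-2 * hurwitzSum 3 x ^ 2 + 3 * (hurwitzSum 2 x * hurwitzSum 4 x)) /
      hurwitzSum 3 x ^ 2 * x - hurwitzRatio x * 1 =
      (3 * x * (hurwitzSum 2 x * hurwitzSum 4 x) -
        (hurwitzSum 2 x * hurwitzSum 3 x + 2 * x * hurwitzSum 3 x ^ 2)) / hurwitzSum 3 x ^ 2 := by
    rw [hurwitzRatio]
    field_simp
    ring
  rw [e]
  exact div_pos (by linarith) (by positivity)

/-- The ratio `-ψ' / ψ''` is strictly superadditive. -/
lemma hurwitzRatio_add_lt {x y : ℝ} (hx : 0 < x) (hy : 0 < y) :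
    hurwitzRatio x + hurwitzRatio y < hurwitzRatio (x + y) := by
  have hz : 0 < x + y := by positivity
  have h1 : hurwitzRatio x / x < hurwitzRatio (x + y) / (x + y) :=
    strictMonoOn_hurwitzRatio_div hx hz (by linarith)
  have h2 : hurwitzRatio y / y < hurwitzRatio (x + y) / (x + y) :=
    strictMonoOn_hurwitzRatio_div hy hz (by linarith)
  rw [div_lt_iff₀ hx] at h1
  rw [div_lt_iff₀ hy] at h2
  calc _ < _ := add_lt_add h1 h2
    _ = _ := by field_simp

/-- By `hurwitzSum_two_mul_four_le`, R' = 3ζ₂ζ₄/ζ₃² - 2 ≤ 3·4 - 2 = 10. -/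
lemma hurwitzRatio_add_sub_le {x y : ℝ} (hx : 0 < x) (hy : 0 < y) :
    hurwitzRatio (x + y) - hurwitzRatio y ≤ 10 * x := by
  have hd : ∀ x ∈ Ioi (0 : ℝ), HasDerivAt (fun x => 10 * x - hurwitzRatio x) _ x := fun x hx =>
    ((hasDerivAt_id x).const_mul (10 : ℝ)).sub (hasDerivAt_hurwitzRatio hx)
  have hm : MonotoneOn (fun x => 10 * x - hurwitzRatio x) (Ioi 0) := by
    refine monotoneOn_of_deriv_nonneg (convex_Ioi 0)
      (fun x hx => (hd x hx).continuousAt.continuousWithinAt)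
      (fun x hx => (hd x (interior_subset hx)).differentiableAt.differentiableWithinAt)
      fun x hx => ?_
    rw [interior_Ioi] at hx
    rw [(hd x hx).deriv, sub_nonneg, div_le_iff₀ (pow_pos (hurwitzSum_pos (by norm_num) hx) 2)]
    have := hurwitzSum_two_mul_four_le hx
    linarith
  have := hm hy (show x + y ∈ Ioi 0 from add_pos hx hy) (by linarith)
  simp only at this
  linarith

lemma monotoneOn_inv_mul_hurwitzSum_two_sub :
    MonotoneOn (fun x => (x * hurwitzSum 2 x)⁻¹ - x / (x + 1) / 4) (Ioi 0) := by
  have hd : ∀ x ∈ Ioi (0 : ℝ),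
      HasDerivAt (fun x => (x * hurwitzSum 2 x)⁻¹ - x / (x + 1) / 4) _ x := fun x hx =>
    (((hasDerivAt_id x).mul (hasDerivAt_hurwitzSum le_rfl hx)).inv
      (mul_pos hx (hurwitzSum_pos le_rfl hx)).ne').sub
      ((((hasDerivAt_id x).div ((hasDerivAt_id x).add_const 1)
        (add_pos hx one_pos : 0 < x + 1).ne')).div_const 4)
  refine monotoneOn_of_deriv_nonneg (convex_Ioi 0)
    (fun x hx => (hd x hx).continuousAt.continuousWithinAt)
    (fun x hx => (hd x (interior_subset hx)).differentiableAt.differentiableWithinAt)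
    fun x hx => ?_
  rw [interior_Ioi] at hx
  have hx0 : 0 < x := hx
  have h2 := hurwitzSum_pos le_rfl hx0
  rw [(hd x hx).deriv, sub_nonneg]
  simp only [id, Nat.cast_ofNat, Pi.mul_apply]
  norm_num only [Nat.reduceAdd]
  have e1 : (1 * (x + 1) - x * 1) / (x + 1) ^ 2 / 4 = 1 / (4 * (x + 1) ^ 2) := by
    field_simp
    ring
  have e2 : -(1 * hurwitzSum 2 x + x * (-2 * hurwitzSum 3 x)) / (x * hurwitzSum 2 x) ^ 2 =
      (2 * x * hurwitzSum 3 x - hurwitzSum 2 x) / (x * hurwitzSum 2 x) ^ 2 := by ring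
  rw [e1, e2]
  -- Here x (1/x + 1/x²) = (x + 1)/x, and 1/x + 1/x² is the upper bound for ζ₂.
  calc 1 / (4 * (x + 1) ^ 2) = 1 / (4 * x ^ 2) / (x * (1 / x + 1 / x ^ 2)) ^ 2 := by field_simp
    _ ≤ (2 * x * hurwitzSum 3 x - hurwitzSum 2 x) / (x * hurwitzSum 2 x) ^ 2 := by
      have h := le_two_mul_hurwitzSum_three_sub hx0
      have h' : 0 ≤ 1 / (4 * x ^ 2) := by positivity
      have h'' := hurwitzSum_two_le_inv_add_inv_sq hx0
      gcongr
      linarith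

/-- The reciprocal of `ψ'` is superadditive, quantitatively. -/
lemma le_inv_hurwitzSum_two_add_sub {x y : ℝ} (hx : 0 < x) (hy : 0 < y) :
    x / (x + 1) * (y / (y + 1)) / 4 ≤
      (hurwitzSum 2 (x + y))⁻¹ - (hurwitzSum 2 x)⁻¹ - (hurwitzSum 2 y)⁻¹ := by
  have hz : 0 < x + y := by positivity
  have h1 := monotoneOn_inv_mul_hurwitzSum_two_sub hx hz (by linarith)
  have h2 := monotoneOn_inv_mul_hurwitzSum_two_sub hy hz (by linarith)
  simp only at h1 h2
  -- With 1/ζ₂(t) = t h(t), the defect is x(h(x+y) - h(x)) + y(h(x+y) - h(y)), and the increments of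
  -- h dominate those of t/(4(t + 1)).
  have e : ∀ t : ℝ, 0 < t → (hurwitzSum 2 t)⁻¹ = t * (t * hurwitzSum 2 t)⁻¹ := by
    intro t ht
    have := hurwitzSum_pos le_rfl ht
    field_simp
  rw [e _ hx, e _ hy, e _ hz]
  have h3 := mul_le_mul_of_nonneg_left h1 hx.le
  have h4 := mul_le_mul_of_nonneg_left h2 hy.le
  have h5 : x / (x + 1) * (y / (y + 1)) / 4 ≤
      x * ((x + y) / (x + y + 1) / 4 - x / (x + 1) / 4) +
      y * ((x + y) / (x + y + 1) / 4 - y / (y + 1) / 4) := by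
    rw [← sub_nonneg]
    have : x * ((x + y) / (x + y + 1) / 4 - x / (x + 1) / 4) +
      y * ((x + y) / (x + y + 1) / 4 - y / (y + 1) / 4) - x / (x + 1) * (y / (y + 1)) / 4 =
      x * y / (4 * (x + 1) * (y + 1) * (x + y + 1)) := by
      field_simp
      ring
    rw [this]
    positivity
  linarith

/-- The quotient behaves like x at 0 and tends to 1/2 at infinity, the profile of x/(x + 1) up to
constants. -/
lemma hurwitzSum_three_div_sq_le {x : ℝ} (hx : 0 < x) :
    hurwitzSum 3 x / hurwitzSum 2 x ^ 2 ≤ 4 * (x / (x + 1)) := by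
  calc hurwitzSum 3 x / hurwitzSum 2 x ^ 2
      ≤ (1 / (2 * x ^ 2) + 1 / x ^ 3) / (1 / x + 1 / (2 * x ^ 2)) ^ 2 := by
        have h3 := hurwitzSum_three_le_inv_sq_add_inv_cube hx
        have h2 := le_hurwitzSum_two hx
        gcongr
    _ ≤ 4 * (x / (x + 1)) := by
        rw [← sub_nonneg]
        have : 4 * (x / (x + 1)) - (1 / (2 * x ^ 2) + 1 / x ^ 3) / (1 / x + 1 / (2 * x ^ 2)) ^ 2 =
          2 * x ^ 2 * (7 * x + 5) / ((x + 1) * (2 * x + 1) ^ 2) := by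
          field_simp
          ring
        rw [this]
        positivity

/-! ### The Gauss curvature of the beta manifold -/

/-- The determinant of the Fisher–Rao metric of the beta family at `(x, y)`. -/
noncomputable def betaDet (x y : ℝ) : ℝ :=
  hurwitzSum 2 x * hurwitzSum 2 y - hurwitzSum 2 (x + y) * (hurwitzSum 2 x + hurwitzSum 2 y)

/-- The Gauss curvature of the Fisher–Rao metric of the beta family at `(x, y)`. -/
noncomputable def betaCurvature (x y : ℝ) : ℝ :=
  (hurwitzSum 2 x * hurwitzSum 3 y * hurwitzSum 3 (x + y) +
    hurwitzSum 2 y * hurwitzSum 3 x * hurwitzSum 3 (x + y) -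
    hurwitzSum 2 (x + y) * hurwitzSum 3 x * hurwitzSum 3 y) / betaDet x y ^ 2

lemma betaDet_eq {x y : ℝ} (hx : 0 < x) (hy : 0 < y) :
    betaDet x y = hurwitzSum 2 x * hurwitzSum 2 y * hurwitzSum 2 (x + y) *
      ((hurwitzSum 2 (x + y))⁻¹ - (hurwitzSum 2 x)⁻¹ - (hurwitzSum 2 y)⁻¹) := by
  have h1 := hurwitzSum_pos le_rfl hx
  have h2 := hurwitzSum_pos le_rfl hy
  have h3 := hurwitzSum_pos le_rfl (add_pos hx hy)
  rw [betaDet]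
  field_simp
  ring

lemma inv_hurwitzSum_two_add_sub_pos {x y : ℝ} (hx : 0 < x) (hy : 0 < y) :
    0 < (hurwitzSum 2 (x + y))⁻¹ - (hurwitzSum 2 x)⁻¹ - (hurwitzSum 2 y)⁻¹ :=
  lt_of_lt_of_le (by positivity) (le_inv_hurwitzSum_two_add_sub hx hy)

lemma betaDet_pos {x y : ℝ} (hx : 0 < x) (hy : 0 < y) : 0 < betaDet x y := by
  rw [betaDet_eq hx hy]
  have h1 := hurwitzSum_pos le_rfl hx
  have h2 := hurwitzSum_pos le_rfl hy
  have h3 := hurwitzSum_pos le_rfl (add_pos hx hy)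
  have := inv_hurwitzSum_two_add_sub_pos hx hy
  positivity

lemma hurwitzSum_two_add_lt {x y : ℝ} (hx : 0 < x) (hy : 0 < y) :
    hurwitzSum 2 (x + y) < hurwitzSum 2 x := by
  have h1 := hurwitzSum_pos le_rfl hx
  have h2 := hurwitzSum_pos le_rfl hy
  have h3 := hurwitzSum_pos le_rfl (add_pos hx hy)
  have := inv_hurwitzSum_two_add_sub_pos hx hy
  have : 0 < (hurwitzSum 2 y)⁻¹ := by positivity
  exact (inv_lt_inv₀ h1 h3).1 (by linarith)

/-- Separates the sign, carried by the superadditivity defect of R, from positive factors that can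
be estimated one by one. -/
lemma betaCurvature_eq {x y : ℝ} (hx : 0 < x) (hy : 0 < y) :
    betaCurvature x y = -(hurwitzSum 3 x / hurwitzSum 2 x ^ 2 *
      (hurwitzSum 3 y / hurwitzSum 2 y ^ 2) *
      (hurwitzSum 3 (x + y) / hurwitzSum 2 (x + y) ^ 2) *
      (hurwitzRatio (x + y) - hurwitzRatio x - hurwitzRatio y) /
      ((hurwitzSum 2 (x + y))⁻¹ - (hurwitzSum 2 x)⁻¹ - (hurwitzSum 2 y)⁻¹) ^ 2) := by
  have h1 := hurwitzSum_pos le_rfl hx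
  have h2 := hurwitzSum_pos le_rfl hy
  have h3 := hurwitzSum_pos le_rfl (add_pos hx hy)
  have k1 := hurwitzSum_pos (k := 3) (by norm_num) hx
  have k2 := hurwitzSum_pos (k := 3) (by norm_num) hy
  have k3 := hurwitzSum_pos (k := 3) (by norm_num) (add_pos hx hy)
  have hS := inv_hurwitzSum_two_add_sub_pos hx hy
  rw [betaCurvature, betaDet_eq hx hy]
  generalize (hurwitzSum 2 (x + y))⁻¹ - (hurwitzSum 2 x)⁻¹ - (hurwitzSum 2 y)⁻¹ = S at *
  rw [hurwitzRatio, hurwitzRatio, hurwitzRatio]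
  field_simp
  ring

lemma betaCurvature_neg {x y : ℝ} (hx : 0 < x) (hy : 0 < y) : betaCurvature x y < 0 := by
  have h1 := hurwitzSum_pos le_rfl hx
  have h2 := hurwitzSum_pos le_rfl hy
  have h3 := hurwitzSum_pos le_rfl (add_pos hx hy)
  have k1 := hurwitzSum_pos (k := 3) (by norm_num) hx
  have k2 := hurwitzSum_pos (k := 3) (by norm_num) hy
  have k3 := hurwitzSum_pos (k := 3) (by norm_num) (add_pos hx hy)
  have hS := inv_hurwitzSum_two_add_sub_pos hx hy
  have hR : 0 < hurwitzRatio (x + y) - hurwitzRatio x - hurwitzRatio y := by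
    have := hurwitzRatio_add_lt hx hy
    linarith
  rw [betaCurvature_eq hx hy, neg_lt_zero]
  positivity

lemma hurwitzRatio_pos {x : ℝ} (hx : 0 < x) : 0 < hurwitzRatio x :=
  div_pos (hurwitzSum_pos le_rfl hx) (hurwitzSum_pos (by norm_num) hx)

/-- For x ≤ 1 the slope bound gives 10x; for x ≥ 1 the bounds 2t - 3 ≤ R(t) ≤ 2t give 6. -/
lemma hurwitzRatio_add_sub_sub_le {x y : ℝ} (hx : 0 < x) (hy : 0 < y) :
    hurwitzRatio (x + y) - hurwitzRatio x - hurwitzRatio y ≤ 20 * (x / (x + 1)) := by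
  rcases le_total x 1 with h | h
  · have h1 := hurwitzRatio_add_sub_le hx hy
    have h2 := hurwitzRatio_pos hx
    have h3 : 10 * x ≤ 20 * (x / (x + 1)) := by
      rw [mul_div_assoc', le_div_iff₀ (by positivity)]
      nlinarith
    linarith
  · have h1 := hurwitzRatio_le (add_pos hx hy)
    have h2 := le_hurwitzRatio hx
    have h3 := le_hurwitzRatio hy
    have h4 : 6 ≤ 20 * (x / (x + 1)) := by
      rw [mul_div_assoc', le_div_iff₀ (by positivity)]
      linarith
    linarith

lemma add_div_add_one_le {x y : ℝ} (hx : 0 < x) (hxy : x ≤ y) :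
    (x + y) / (x + y + 1) ≤ 2 * (y / (y + 1)) := by
  have hy : 0 < y := hx.trans_le hxy
  rw [mul_div_assoc', div_le_div_iff₀ (by positivity) (by positivity)]
  nlinarith

lemma le_betaCurvature_of_le {x y : ℝ} (hx : 0 < x) (hxy : x ≤ y) :
    -40960 ≤ betaCurvature x y := by
  have hy : 0 < y := hx.trans_le hxy
  have hz := add_pos hx hy
  have k (t : ℝ) (ht : 0 < t) : 0 < hurwitzSum 3 t / hurwitzSum 2 t ^ 2 :=
    div_pos (hurwitzSum_pos (by norm_num) ht) (pow_pos (hurwitzSum_pos le_rfl ht) 2)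
  have k1 := k x hx
  have k2 := k y hy
  have k3 := k _ hz
  have j1 := hurwitzSum_three_div_sq_le hx
  have j2 := hurwitzSum_three_div_sq_le hy
  have j3 := (hurwitzSum_three_div_sq_le hz).trans
    (mul_le_mul_of_nonneg_left (add_div_add_one_le hx hxy) (by norm_num))
  have hR0 : 0 ≤ hurwitzRatio (x + y) - hurwitzRatio x - hurwitzRatio y := by
    have := hurwitzRatio_add_lt hx hy
    linarith
  have hR := hurwitzRatio_add_sub_sub_le hx hy
  have hS := le_inv_hurwitzSum_two_add_sub hx hy
  have hS0 := inv_hurwitzSum_two_add_sub_pos hx hy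
  rw [betaCurvature_eq hx hy]
  generalize (hurwitzSum 2 (x + y))⁻¹ - (hurwitzSum 2 x)⁻¹ - (hurwitzSum 2 y)⁻¹ = S at *
  generalize hurwitzRatio (x + y) - hurwitzRatio x - hurwitzRatio y = R at *
  generalize hurwitzSum 3 x / hurwitzSum 2 x ^ 2 = P at *
  generalize hurwitzSum 3 y / hurwitzSum 2 y ^ 2 = Q at *
  generalize hurwitzSum 3 (x + y) / hurwitzSum 2 (x + y) ^ 2 = T at *
  have hm : 0 < x / (x + 1) := by positivity
  have hn : 0 < y / (y + 1) := by positivity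
  generalize x / (x + 1) = m at *
  generalize y / (y + 1) = n at *
  rw [neg_le_neg_iff, div_le_iff₀ (by positivity)]
  -- With x ≤ y, the factors P and R supply m² and the factors Q and T supply n², matching S²;
  -- 4·4·8·20·16 = 40960.
  calc P * Q * T * R ≤ (4 * m) * (4 * n) * (4 * (2 * n)) * (20 * m) := by gcongr
    _ = 40960 * (m * n / 4) ^ 2 := by ring
    _ ≤ 40960 * S ^ 2 := by gcongr

lemma betaCurvature_comm (x y : ℝ) : betaCurvature x y = betaCurvature y x := by
  rw [betaCurvature, betaCurvature, betaDet, betaDet, add_comm y x]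
  ring

lemma le_betaCurvature {x y : ℝ} (hx : 0 < x) (hy : 0 < y) : -40960 ≤ betaCurvature x y := by
  rcases le_total x y with h | h
  · exact le_betaCurvature_of_le hx h
  · rw [betaCurvature_comm]
    exact le_betaCurvature_of_le hy h

namespace BetaGeometry

/-! ### Partial derivatives and sectional curvature in dimension two -/

lemma partialDeriv_zero_apply (f : (Fin 2 → ℝ) → ℝ) (x y : ℝ) :
    partialDeriv 0 f ![x, y] = deriv (fun t => f ![t, y]) x := by
  have h (t : ℝ) : (![x, y] + t • Pi.single 0 1 : Fin 2 → ℝ) = ![x + t, y] := by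
    ext i
    fin_cases i <;> simp
  simp only [partialDeriv, lineDeriv, h]
  rw [deriv_comp_const_add (f := fun t => f ![t, y]), add_zero]

lemma partialDeriv_one_apply (f : (Fin 2 → ℝ) → ℝ) (x y : ℝ) :
    partialDeriv 1 f ![x, y] = deriv (fun t => f ![x, t]) y := by
  have h (t : ℝ) : (![x, y] + t • Pi.single 1 1 : Fin 2 → ℝ) = ![x, y + t] := by
    ext i
    fin_cases i <;> simp
  simp only [partialDeriv, lineDeriv, h]
  rw [deriv_comp_const_add (f := fun t => f ![x, t]), add_zero]

lemma riemannTensor_swap {d : ℕ} (g : (Fin d → ℝ) → Matrix (Fin d) (Fin d) ℝ) (l i j k : Fin d)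
    (θ : Fin d → ℝ) : riemannTensor g l j i k θ = -riemannTensor g l i j k θ := by
  have : ∀ m, christoffel g l j m θ * christoffel g m i k θ
      - christoffel g l i m θ * christoffel g m j k θ =
      -(christoffel g l i m θ * christoffel g m j k θ
      - christoffel g l j m θ * christoffel g m i k θ) := fun m => by ring
  simp only [riemannTensor, this, Finset.sum_neg_distrib]
  ring

lemma riemannTensor_self {d : ℕ} (g : (Fin d → ℝ) → Matrix (Fin d) (Fin d) ℝ) (l i k : Fin d)
    (θ : Fin d → ℝ) : riemannTensor g l i i k θ = 0 := by
  have := riemannTensor_swap g l i i k θ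
  linarith

lemma det_ne_zero_of_linearIndependent {u v : Fin 2 → ℝ} (h : LinearIndependent ℝ ![u, v]) :
    u 0 * v 1 - u 1 * v 0 ≠ 0 := by
  rw [LinearIndependent.pair_iff] at h
  intro h0
  -- If the determinant vanishes, both v₀u - u₀v and v₁u - u₁v are zero, so independence forces u =
  -- 0.
  have h1 := h (v 0) (-u 0) (by
    ext i
    fin_cases i
    · simp; ring
    · simp; linarith)
  have h2 := h (v 1) (-u 1) (by
    ext i
    fin_cases i
    · simp; linarith
    · simp; ring)
  have h3 := h 1 0 (by
    ext i
    fin_cases i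
    · simpa using h1.2
    · simpa using h2.2)
  exact one_ne_zero h3.1

/-- If `R(∂₀, ∂₁)∂ₖ = K (g₁ₖ ∂₀ - g₀ₖ ∂₁)`, then `K` is the sectional curvature. -/
lemma sectionalCurvature_eq_of_riemannTensor {g : (Fin 2 → ℝ) → Matrix (Fin 2) (Fin 2) ℝ}
    {θ : Fin 2 → ℝ} {K : ℝ} (hsymm : g θ 1 0 = g θ 0 1) (hdet : (g θ).det ≠ 0)
    (h0 : ∀ k, riemannTensor g 0 0 1 k θ = K * g θ 1 k)
    (h1 : ∀ k, riemannTensor g 1 0 1 k θ = -(K * g θ 0 k))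
    {u v : Fin 2 → ℝ} (huv : LinearIndependent ℝ ![u, v]) :
    sectionalCurvature g θ u v = K := by
  have huv := det_ne_zero_of_linearIndependent huv
  rw [Matrix.det_fin_two, hsymm] at hdet
  have hD : metricInner g θ u u * metricInner g θ v v - metricInner g θ u v ^ 2 =
      (g θ 0 0 * g θ 1 1 - g θ 0 1 * g θ 0 1) * (u 0 * v 1 - u 1 * v 0) ^ 2 := by
    simp only [metricInner, Fin.sum_univ_two, hsymm]
    ring
  rw [sectionalCurvature, div_eq_iff (by rw [hD]; positivity), hD]
  simp only [metricInner, curvatureVector, Fin.sum_univ_two, riemannTensor_self,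
    riemannTensor_swap g _ 0 1, h0, h1, hsymm]
  ring

/-! ### The Fisher information of the beta family -/

lemma log_betaDensity {α β x : ℝ} (hα : 0 < α) (hβ : 0 < β) (hx : x ∈ Ioo (0 : ℝ) 1) :
    Real.log (betaDensity ![α, β] x) = Real.log (Real.Gamma (α + β)) - Real.log (Real.Gamma α)
      - Real.log (Real.Gamma β) + (α - 1) * Real.log x + (β - 1) * Real.log (1 - x) := by
  have h1 := Real.Gamma_pos_of_pos hα
  have h2 := Real.Gamma_pos_of_pos hβ
  have h3 := Real.Gamma_pos_of_pos (add_pos hα hβ)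
  have hx0 : 0 < x := hx.1
  have hx1 : 0 < 1 - x := sub_pos.2 hx.2
  simp only [betaDensity, betaPDFReal, ProbabilityTheory.beta, Matrix.cons_val_zero,
    Matrix.cons_val_one]
  rw [if_pos ⟨hx.1, hx.2⟩, one_div_div, Real.log_mul (by positivity) (by positivity),
    Real.log_mul (by positivity) (by positivity), Real.log_div (by positivity) (by positivity),
    Real.log_mul (by positivity) (by positivity), Real.log_rpow hx0, Real.log_rpow hx1]
  ring

lemma partialDeriv_zero_log_betaDensity {α β x : ℝ} (hα : 0 < α) (hβ : 0 < β)
    (hx : x ∈ Ioo (0 : ℝ) 1) :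
    partialDeriv 0 (fun η => Real.log (betaDensity η x)) ![α, β] =
      logDeriv Real.Gamma (α + β) - logDeriv Real.Gamma α + Real.log x := by
  rw [partialDeriv_zero_apply]
  have h := ((((Real.hasDerivAt_log_Gamma (add_pos hα hβ)).comp_add_const α β).sub
    (Real.hasDerivAt_log_Gamma hα)).sub_const (Real.log (Real.Gamma β))).add
    (((hasDerivAt_id α).sub_const 1).mul_const (Real.log x))
  rw [((h.add_const ((β - 1) * Real.log (1 - x))).congr_of_eventuallyEq
    ((lt_mem_nhds hα).mono fun t ht => log_betaDensity ht hβ hx)).deriv, one_mul]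

lemma partialDeriv_one_log_betaDensity {α β x : ℝ} (hα : 0 < α) (hβ : 0 < β)
    (hx : x ∈ Ioo (0 : ℝ) 1) :
    partialDeriv 1 (fun η => Real.log (betaDensity η x)) ![α, β] =
      logDeriv Real.Gamma (α + β) - logDeriv Real.Gamma β + Real.log (1 - x) := by
  rw [partialDeriv_one_apply]
  have h := (((((Real.hasDerivAt_log_Gamma (add_pos hα hβ)).comp_const_add α β).sub_const
    (Real.log (Real.Gamma α))).sub (Real.hasDerivAt_log_Gamma hβ)).add_const
    ((α - 1) * Real.log x)).add
    (((hasDerivAt_id β).sub_const 1).mul_const (Real.log (1 - x)))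
  rw [(h.congr_of_eventuallyEq
    ((lt_mem_nhds hβ).mono fun t ht => log_betaDensity hα ht hx)).deriv, one_mul]

/-- The matrix of the Fisher–Rao metric of the beta family at `(x, y)`, in terms of `ψ'`. -/
noncomputable def betaMatrix (x y : ℝ) : Matrix (Fin 2) (Fin 2) ℝ :=
  !![hurwitzSum 2 x - hurwitzSum 2 (x + y), -hurwitzSum 2 (x + y);
    -hurwitzSum 2 (x + y), hurwitzSum 2 y - hurwitzSum 2 (x + y)]

/-- The family is exponential: x enters ln p only through terms affine in the parameters, which two
derivatives remove. -/
lemma logDensityHessian_betaDensity {α β x : ℝ} (hα : 0 < α) (hβ : 0 < β)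
    (hx : x ∈ Ioo (0 : ℝ) 1) (i j : Fin 2) :
    logDensityHessian betaDensity i j ![α, β] x = -betaMatrix α β i j := by
  have hs := Real.hasDerivAt_logDeriv_Gamma (add_pos hα hβ)
  have ha := Real.hasDerivAt_logDeriv_Gamma hα
  have hb := Real.hasDerivAt_logDeriv_Gamma hβ
  rw [logDensityHessian]
  fin_cases i <;> fin_cases j
  · simp only [Fin.zero_eta, partialDeriv_zero_apply (partialDeriv _ _)]
    refine ((((hs.comp_add_const α β).sub ha).add_const (Real.log x)).congr_of_eventuallyEq
      ((lt_mem_nhds hα).mono fun t ht =>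
        partialDeriv_zero_log_betaDensity ht hβ hx)).deriv.trans ?_
    simp [betaMatrix]
  · simp only [Fin.zero_eta, Fin.mk_one, partialDeriv_zero_apply (partialDeriv _ _)]
    refine ((((hs.comp_add_const α β).sub_const (logDeriv Real.Gamma β)).add_const
      (Real.log (1 - x))).congr_of_eventuallyEq ((lt_mem_nhds hα).mono fun t ht =>
        partialDeriv_one_log_betaDensity ht hβ hx)).deriv.trans ?_
    simp [betaMatrix]
  · simp only [Fin.zero_eta, Fin.mk_one, partialDeriv_one_apply (partialDeriv _ _)]
    refine ((((hs.comp_const_add α β).sub_const (logDeriv Real.Gamma α)).add_const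
      (Real.log x)).congr_of_eventuallyEq ((lt_mem_nhds hβ).mono fun t ht =>
        partialDeriv_zero_log_betaDensity hα ht hx)).deriv.trans ?_
    simp [betaMatrix]
  · simp only [Fin.mk_one, partialDeriv_one_apply (partialDeriv _ _)]
    refine ((((hs.comp_const_add α β).sub hb).add_const (Real.log (1 - x))).congr_of_eventuallyEq
      ((lt_mem_nhds hβ).mono fun t ht =>
        partialDeriv_one_log_betaDensity hα ht hx)).deriv.trans ?_
    simp [betaMatrix]

lemma densityMeasure_betaDensity (α β : ℝ) :
    densityMeasure volume betaDensity ![α, β] = betaMeasure α β := rfl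

lemma ae_mem_Ioo_betaMeasure (α β : ℝ) : ∀ᵐ x ∂(betaMeasure α β), x ∈ Ioo (0 : ℝ) 1 := by
  have hm : Measurable (betaPDF α β) := (measurable_betaPDFReal α β).ennreal_ofReal
  rw [betaMeasure, ae_withDensity_iff hm]
  refine ae_of_all _ fun x hx => ?_
  by_contra h
  refine hx ?_
  rw [betaPDF_eq, if_neg (show ¬(0 < x ∧ x < 1) from h), ENNReal.ofReal_zero]

lemma logDensityHessian_betaDensity_ae {α β : ℝ} (hα : 0 < α) (hβ : 0 < β) (i j : Fin 2) :
    logDensityHessian betaDensity i j ![α, β] =ᵐ[betaMeasure α β]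
      fun _ => -betaMatrix α β i j :=
  (ae_mem_Ioo_betaMeasure α β).mono fun _ hx => logDensityHessian_betaDensity hα hβ hx i j

lemma integrable_logDensityHessian_betaDensity {α β : ℝ} (hα : 0 < α) (hβ : 0 < β)
    (i j : Fin 2) : Integrable (logDensityHessian betaDensity i j ![α, β])
      (densityMeasure volume betaDensity ![α, β]) := by
  rw [densityMeasure_betaDensity]
  have := isProbabilityMeasureBeta hα hβ
  exact (integrable_const _).congr (logDensityHessian_betaDensity_ae hα hβ i j).symm

lemma betaFisherMetric_apply {α β : ℝ} (hα : 0 < α) (hβ : 0 < β) :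
    betaFisherMetric ![α, β] = betaMatrix α β := by
  ext i j
  have := isProbabilityMeasureBeta hα hβ
  rw [betaFisherMetric, fisherInformation, Matrix.of_apply, densityMeasure_betaDensity,
    integral_congr_ae (logDensityHessian_betaDensity_ae hα hβ i j)]
  simp

lemma vec_eta (θ : Fin 2 → ℝ) : ![θ 0, θ 1] = θ := by
  ext i
  fin_cases i <;> rfl

lemma det_betaMatrix (x y : ℝ) : (betaMatrix x y).det = betaDet x y := by
  rw [Matrix.det_fin_two, betaDet]
  simp [betaMatrix]
  ring

lemma posDef_betaMatrix {x y : ℝ} (hx : 0 < x) (hy : 0 < y) : (betaMatrix x y).PosDef := by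
  have hdet := betaDet_pos hx hy
  have h0 : 0 < hurwitzSum 2 x - hurwitzSum 2 (x + y) := sub_pos.2 (hurwitzSum_two_add_lt hx hy)
  refine Matrix.PosDef.of_dotProduct_mulVec_pos ?_ fun v hv => ?_
  · ext i j
    fin_cases i <;> fin_cases j <;> simp [betaMatrix]
  -- Completing the square after multiplying the form by its upper-left entry.
  · have e : (hurwitzSum 2 x - hurwitzSum 2 (x + y)) * (star v ⬝ᵥ (betaMatrix x y).mulVec v) =
        ((hurwitzSum 2 x - hurwitzSum 2 (x + y)) * v 0 - hurwitzSum 2 (x + y) * v 1) ^ 2 +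
          betaDet x y * v 1 ^ 2 := by
      simp [betaMatrix, betaDet, dotProduct, Matrix.mulVec, Fin.sum_univ_two]
      ring
    refine (mul_pos_iff_of_pos_left h0).1 ?_
    rw [e]
    rcases eq_or_ne (v 1) 0 with h1 | h1
    · have : v 0 ≠ 0 := fun h => hv (by ext i; fin_cases i <;> simpa)
      rw [h1]
      have := mul_ne_zero h0.ne' this
      simp only [mul_zero, sub_zero]
      positivity
    · positivity

lemma contDiffOn_betaMatrix (i j : Fin 2) :
    ContDiffOn ℝ ∞ (fun θ : Fin 2 → ℝ => betaMatrix (θ 0) (θ 1) i j) betaParameters := by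
  have h : ContDiffOn ℝ ∞ (hurwitzSum 2) (Ioi 0) :=
    contDiffOn_infty.2 (contDiffOn_hurwitzSum le_rfl)
  have ha : ContDiffOn ℝ ∞ (fun θ : Fin 2 → ℝ => hurwitzSum 2 (θ 0)) betaParameters :=
    h.comp (contDiff_apply ℝ ℝ (0 : Fin 2)).contDiffOn fun θ hθ => hθ.1
  have hb : ContDiffOn ℝ ∞ (fun θ : Fin 2 → ℝ => hurwitzSum 2 (θ 1)) betaParameters :=
    h.comp (contDiff_apply ℝ ℝ (1 : Fin 2)).contDiffOn fun θ hθ => hθ.2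
  have hc : ContDiffOn ℝ ∞ (fun θ : Fin 2 → ℝ => hurwitzSum 2 (θ 0 + θ 1)) betaParameters :=
    h.comp ((contDiff_apply ℝ ℝ (0 : Fin 2)).add (contDiff_apply ℝ ℝ (1 : Fin 2))).contDiffOn
      fun θ hθ => add_pos hθ.1 hθ.2
  fin_cases i <;> fin_cases j
  · exact ha.sub hc
  · exact hc.neg
  · exact hc.neg
  · exact hb.sub hc

lemma isRiemannianMetricOn_betaFisherMetric :
    IsRiemannianMetricOn betaFisherMetric betaParameters where
  posDef θ hθ := by
    rw [← vec_eta θ, betaFisherMetric_apply hθ.1 hθ.2]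
    exact posDef_betaMatrix hθ.1 hθ.2
  smooth i j := (contDiffOn_betaMatrix i j).congr fun θ hθ => by
    conv_lhs => rw [← vec_eta θ, betaFisherMetric_apply hθ.1 hθ.2]

/-! ### The Riemann tensor of the beta manifold -/

lemma inv_betaMatrix (x y : ℝ) : (betaMatrix x y)⁻¹ = (betaDet x y)⁻¹ •
    !![hurwitzSum 2 y - hurwitzSum 2 (x + y), hurwitzSum 2 (x + y);
      hurwitzSum 2 (x + y), hurwitzSum 2 x - hurwitzSum 2 (x + y)] := by
  rw [Matrix.inv_def, det_betaMatrix, Ring.inverse_eq_inv', betaMatrix, Matrix.adjugate_fin_two_of,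
    neg_neg]

lemma hasDerivAt_hurwitzSum_add_const {k : ℕ} (hk : 2 ≤ k) {x y : ℝ} (h : 0 < x + y) :
    HasDerivAt (fun t => hurwitzSum k (t + y)) (-k * hurwitzSum (k + 1) (x + y)) x :=
  (hasDerivAt_hurwitzSum hk h).comp_add_const x y

lemma hasDerivAt_hurwitzSum_const_add {k : ℕ} (hk : 2 ≤ k) {x y : ℝ} (h : 0 < x + y) :
    HasDerivAt (fun t => hurwitzSum k (x + t)) (-k * hurwitzSum (k + 1) (x + y)) y :=
  (hasDerivAt_hurwitzSum hk h).comp_const_add x y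

lemma partialDeriv_zero_betaFisherMetric {x y : ℝ} (hx : 0 < x) (hy : 0 < y) (i j : Fin 2) :
    partialDeriv 0 (fun η => betaFisherMetric η i j) ![x, y] =
      !![2 * hurwitzSum 3 (x + y) - 2 * hurwitzSum 3 x, 2 * hurwitzSum 3 (x + y);
        2 * hurwitzSum 3 (x + y), 2 * hurwitzSum 3 (x + y)] i j := by
  have hc := hasDerivAt_hurwitzSum_add_const le_rfl (add_pos hx hy)
  have ha := hasDerivAt_hurwitzSum le_rfl hx
  rw [partialDeriv_zero_apply, EventuallyEq.deriv_eq
    (f := fun t => betaMatrix t y i j)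
    ((lt_mem_nhds hx).mono fun t ht => by simp only [betaFisherMetric_apply ht hy])]
  fin_cases i <;> fin_cases j
  · refine (ha.sub hc).deriv.trans ?_
    simp
    ring
  · refine hc.neg.deriv.trans ?_
    simp
  · refine hc.neg.deriv.trans ?_
    simp
  · refine (hc.const_sub (hurwitzSum 2 y)).deriv.trans ?_
    simp

lemma partialDeriv_one_betaFisherMetric {x y : ℝ} (hx : 0 < x) (hy : 0 < y) (i j : Fin 2) :
    partialDeriv 1 (fun η => betaFisherMetric η i j) ![x, y] =
      !![2 * hurwitzSum 3 (x + y), 2 * hurwitzSum 3 (x + y);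
        2 * hurwitzSum 3 (x + y), 2 * hurwitzSum 3 (x + y) - 2 * hurwitzSum 3 y] i j := by
  have hc := hasDerivAt_hurwitzSum_const_add le_rfl (add_pos hx hy)
  have hb := hasDerivAt_hurwitzSum le_rfl hy
  rw [partialDeriv_one_apply, EventuallyEq.deriv_eq
    (f := fun t => betaMatrix x t i j)
    ((lt_mem_nhds hy).mono fun t ht => by simp only [betaFisherMetric_apply hx ht])]
  fin_cases i <;> fin_cases j
  · refine (hc.const_sub (hurwitzSum 2 x)).deriv.trans ?_
    simp
  · refine hc.neg.deriv.trans ?_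
    simp
  · refine hc.neg.deriv.trans ?_
    simp
  · refine (hb.sub hc).deriv.trans ?_
    simp
    ring

/-- The numerators `N` of the Christoffel symbols `Γᵏᵢⱼ = N k i j / betaDet` of the beta
manifold. -/
noncomputable def betaChristoffelNum (k i j : Fin 2) (x y : ℝ) : ℝ :=
  ![!![hurwitzSum 2 (x + y) * hurwitzSum 3 x + hurwitzSum 2 y * hurwitzSum 3 (x + y)
        - hurwitzSum 2 y * hurwitzSum 3 x, hurwitzSum 2 y * hurwitzSum 3 (x + y);
      hurwitzSum 2 y * hurwitzSum 3 (x + y),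
        hurwitzSum 2 y * hurwitzSum 3 (x + y) - hurwitzSum 2 (x + y) * hurwitzSum 3 y],
    !![hurwitzSum 2 x * hurwitzSum 3 (x + y) - hurwitzSum 2 (x + y) * hurwitzSum 3 x,
        hurwitzSum 2 x * hurwitzSum 3 (x + y);
      hurwitzSum 2 x * hurwitzSum 3 (x + y),
        hurwitzSum 2 (x + y) * hurwitzSum 3 y + hurwitzSum 2 x * hurwitzSum 3 (x + y)
        - hurwitzSum 2 x * hurwitzSum 3 y]] k i j

lemma christoffel_betaFisherMetric {x y : ℝ} (hx : 0 < x) (hy : 0 < y) (k i j : Fin 2) :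
    christoffel betaFisherMetric k i j ![x, y] = betaChristoffelNum k i j x y / betaDet x y := by
  have hp0 := partialDeriv_zero_betaFisherMetric hx hy
  have hp1 := partialDeriv_one_betaFisherMetric hx hy
  rw [christoffel, betaFisherMetric_apply hx hy, inv_betaMatrix]
  fin_cases k <;> fin_cases i <;> fin_cases j <;>
    (simp [Fin.sum_univ_two, hp0, hp1, betaChristoffelNum]; ring)

lemma hasDerivAt_betaDet_left {x y : ℝ} (hx : 0 < x) (hy : 0 < y) :
    HasDerivAt (fun t => betaDet t y)
      (2 * hurwitzSum 3 (x + y) * (hurwitzSum 2 x + hurwitzSum 2 y)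
        - 2 * hurwitzSum 3 x * (hurwitzSum 2 y - hurwitzSum 2 (x + y))) x := by
  have hc := hasDerivAt_hurwitzSum_add_const le_rfl (add_pos hx hy)
  have ha := hasDerivAt_hurwitzSum le_rfl hx
  refine ((ha.mul_const (hurwitzSum 2 y)).sub
    (hc.mul (ha.add_const (hurwitzSum 2 y)))).congr_deriv ?_
  push_cast
  ring

lemma hasDerivAt_betaDet_right {x y : ℝ} (hx : 0 < x) (hy : 0 < y) :
    HasDerivAt (fun t => betaDet x t)
      (2 * hurwitzSum 3 (x + y) * (hurwitzSum 2 x + hurwitzSum 2 y)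
        - 2 * hurwitzSum 3 y * (hurwitzSum 2 x - hurwitzSum 2 (x + y))) y := by
  have hc := hasDerivAt_hurwitzSum_const_add le_rfl (add_pos hx hy)
  have hb := hasDerivAt_hurwitzSum le_rfl hy
  refine ((hb.const_mul (hurwitzSum 2 x)).sub
    (hc.mul (hb.const_add (hurwitzSum 2 x)))).congr_deriv ?_
  push_cast
  ring

lemma partialDeriv_zero_christoffel {x y N' : ℝ} (hx : 0 < x) (hy : 0 < y) {k i j : Fin 2}
    (h : HasDerivAt (fun t => betaChristoffelNum k i j t y) N' x) :
    partialDeriv 0 (christoffel betaFisherMetric k i j) ![x, y] =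
      (N' * betaDet x y - betaChristoffelNum k i j x y *
        (2 * hurwitzSum 3 (x + y) * (hurwitzSum 2 x + hurwitzSum 2 y)
        - 2 * hurwitzSum 3 x * (hurwitzSum 2 y - hurwitzSum 2 (x + y)))) / betaDet x y ^ 2 := by
  rw [partialDeriv_zero_apply]
  exact ((h.div (hasDerivAt_betaDet_left hx hy) (betaDet_pos hx hy).ne').congr_of_eventuallyEq
    ((lt_mem_nhds hx).mono fun t ht => christoffel_betaFisherMetric ht hy k i j)).deriv

lemma partialDeriv_one_christoffel {x y N' : ℝ} (hx : 0 < x) (hy : 0 < y) {k i j : Fin 2}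
    (h : HasDerivAt (fun t => betaChristoffelNum k i j x t) N' y) :
    partialDeriv 1 (christoffel betaFisherMetric k i j) ![x, y] =
      (N' * betaDet x y - betaChristoffelNum k i j x y *
        (2 * hurwitzSum 3 (x + y) * (hurwitzSum 2 x + hurwitzSum 2 y)
        - 2 * hurwitzSum 3 y * (hurwitzSum 2 x - hurwitzSum 2 (x + y)))) / betaDet x y ^ 2 := by
  rw [partialDeriv_one_apply]
  exact ((h.div (hasDerivAt_betaDet_right hx hy) (betaDet_pos hx hy).ne').congr_of_eventuallyEq
    ((lt_mem_nhds hy).mono fun t ht => christoffel_betaFisherMetric hx ht k i j)).deriv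

/-- The metric is the Hessian of log Γ(α) + log Γ(β) - log Γ(α+β), so the fourth derivatives of this
potential, which appear as ζ₄(x+y), cancel by symmetry and only ζ₂ and ζ₃ remain. -/
lemma riemannTensor_betaFisherMetric {x y : ℝ} (hx : 0 < x) (hy : 0 < y) (l k : Fin 2) :
    riemannTensor betaFisherMetric l 0 1 k ![x, y] =
      ![betaCurvature x y * betaMatrix x y 1 k, -(betaCurvature x y * betaMatrix x y 0 k)] l := by
  have hD := (betaDet_pos hx hy).ne'
  have hz := add_pos hx hy
  have h3 : 2 ≤ 3 := by norm_num
  have a2 := hasDerivAt_hurwitzSum le_rfl hx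
  have b2 := hasDerivAt_hurwitzSum le_rfl hy
  have cl2 := hasDerivAt_hurwitzSum_add_const le_rfl hz
  have cl3 := hasDerivAt_hurwitzSum_add_const h3 hz
  have cr2 := hasDerivAt_hurwitzSum_const_add le_rfl hz
  have cr3 := hasDerivAt_hurwitzSum_const_add h3 hz
  have b3 := hasDerivAt_hurwitzSum h3 hy
  have a3 := hasDerivAt_hurwitzSum h3 hx
  have d010 := partialDeriv_zero_christoffel hx hy (k := 0) (i := 1) (j := 0)
    (cl3.const_mul (hurwitzSum 2 y))
  have d011 := partialDeriv_zero_christoffel hx hy (k := 0) (i := 1) (j := 1)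
    ((cl3.const_mul (hurwitzSum 2 y)).sub (cl2.mul_const (hurwitzSum 3 y)))
  have d110 := partialDeriv_zero_christoffel hx hy (k := 1) (i := 1) (j := 0) (a2.mul cl3)
  have d111 := partialDeriv_zero_christoffel hx hy (k := 1) (i := 1) (j := 1)
    (((cl2.mul_const (hurwitzSum 3 y)).add (a2.mul cl3)).sub (a2.mul_const (hurwitzSum 3 y)))
  have e000 := partialDeriv_one_christoffel hx hy (k := 0) (i := 0) (j := 0)
    (((cr2.mul_const (hurwitzSum 3 x)).add (b2.mul cr3)).sub (b2.mul_const (hurwitzSum 3 x)))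
  have e001 := partialDeriv_one_christoffel hx hy (k := 0) (i := 0) (j := 1) (b2.mul cr3)
  have e100 := partialDeriv_one_christoffel hx hy (k := 1) (i := 0) (j := 0)
    ((cr3.const_mul (hurwitzSum 2 x)).sub (cr2.mul_const (hurwitzSum 3 x)))
  have e101 := partialDeriv_one_christoffel hx hy (k := 1) (i := 0) (j := 1)
    (cr3.const_mul (hurwitzSum 2 x))
  -- The determinant stays opaque while denominators are cleared and is expanded only for the final
  -- polynomial identity.
  have hDe := betaDet.eq_def x y
  simp only [riemannTensor, Fin.sum_univ_two, christoffel_betaFisherMetric hx hy]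
  fin_cases l <;> fin_cases k <;> simp only [Fin.zero_eta, Fin.mk_one, d010, d011, d110, d111,
    e000, e001, e100, e101, betaCurvature] <;> simp [betaChristoffelNum, betaMatrix] <;>
    field_simp <;> rw [hDe] <;> ring

lemma sectionalCurvature_betaFisherMetric {θ : Fin 2 → ℝ} (hθ : θ ∈ betaParameters)
    {u v : Fin 2 → ℝ} (huv : LinearIndependent ℝ ![u, v]) :
    sectionalCurvature betaFisherMetric θ u v = betaCurvature (θ 0) (θ 1) := by
  have h := riemannTensor_betaFisherMetric hθ.1 hθ.2
  have hg := betaFisherMetric_apply hθ.1 hθ.2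
  rw [vec_eta] at h hg
  refine sectionalCurvature_eq_of_riemannTensor (by rw [hg]; rfl)
    (by rw [hg, det_betaMatrix]; exact (betaDet_pos hθ.1 hθ.2).ne') (fun k => ?_) (fun k => ?_) huv
  · rw [h, hg]
    rfl
  · rw [h, hg]
    rfl

end BetaGeometry

theorem mainTheorem1 :
    -- the Fisher information of the beta family exists and is a Riemannian metric on `(0, ∞)²`
    (∀ θ ∈ betaParameters, ∀ i j : Fin 2,
      MeasureTheory.Integrable (logDensityHessian betaDensity i j θ)
        (densityMeasure MeasureTheory.volume betaDensity θ)) ∧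
    IsRiemannianMetricOn betaFisherMetric betaParameters ∧
    -- its sectional curvature is negative everywhere
    (∀ θ ∈ betaParameters, ∀ u v : Fin 2 → ℝ, LinearIndependent ℝ ![u, v] →
      sectionalCurvature betaFisherMetric θ u v < 0) ∧
    -- and bounded from below, uniformly over the whole parameter space
    (∃ C : ℝ, ∀ θ ∈ betaParameters, ∀ u v : Fin 2 → ℝ, LinearIndependent ℝ ![u, v] →
      C ≤ sectionalCurvature betaFisherMetric θ u v) := by
  refine ⟨fun θ hθ i j => ?_, isRiemannianMetricOn_betaFisherMetric, fun θ hθ u v huv => ?_,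
    -40960, fun θ hθ u v huv => ?_⟩
  · have := integrable_logDensityHessian_betaDensity hθ.1 hθ.2 i j
    rwa [vec_eta] at this
  · rw [sectionalCurvature_betaFisherMetric hθ huv]
    exact betaCurvature_neg hθ.1 hθ.2
  · rw [sectionalCurvature_betaFisherMetric hθ huv]
    exact le_betaCurvature hθ.1 hθ.2
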